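/- Let $T$ be a finite rooted tree with vertex set $V$, and let $D\subseteq V$. For an integer $n\ge |V|$ let $G(T;n)$ be the rooted tree with $n$ vertices obtained from $T$ by adding a chain of $n-|V|$ vertices above the root of $T$ (so $G(T;|V|)=T$). A labeling of a rooted tree with $n$ vertices is a bijection $w$ from its vertices to $\{1,\dots,n\}$; its descent set $\mathrm{Des}(w)$ is the set of vertices $v$, other than the root, such that $w(v)>w(p(v))$, where $p(v)$ is the parent of $v$. Let $d(T;n)$ be the number of labelings $w$ of $G(T;n)$ with $\mathrm{Des}(w)=D$. For $N\subseteq D$ delete from $G(T;n)$ the edges between the vertices in $N$ and their parents (nothing is deleted at a vertex that is the root of $G(T;n)$), and let $\mathcal F_n(N)$ be the set of connected components of the resulting forest. Each component is a rooted tree with the inherited parent relation, and for a vertex $v$ of a component $C$ let $h_v^{C}$ be the hook length of $v$ within $C$, that is, the number of vertices of the subtree of $C$ rooted at $v$. Then for every $n\ge |V|$ $$d(T;n)=n!\sum_{N\subseteq D}(-1)^{|D|-|N|}\prod_{C\in\mathcal F_n(N)}\frac{1}{\prod_{v\in C}h_v^{C}} .$$ In particular, for $n=|V|$ the formula holds with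 the trees $C$ obtained by cutting $T$ itself. -/

import Mathlib

/-!
A finite rooted tree is Mathlib's `RootedTree` with finitely many vertices: `⊥` is the root,
`u ≤ v` means that `u` is an ancestor of `v` (or `u = v`), and `Order.pred v` is the parent `p(v)`
of a vertex `v ≠ ⊥`, while `Order.pred ⊥ = ⊥`.
-/

namespace RootedTree

open scoped Classical in
instance isPredArchimedean_withBot (T : RootedTree) : IsPredArchimedean (WithBot T) where
  exists_pred_iterate_of_le {a b} h := by
    have key : ∀ (n : ℕ) (x : T), Order.pred^[n] x = ⊥ →
        ∃ m, Order.pred^[m] (x : WithBot T) = ⊥ := by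
      intro n
      induction n with
      | zero =>
        intro x hx
        refine ⟨1, ?_⟩
        have hx' : x = ⊥ := hx
        subst hx'
        exact WithBot.pred_coe_of_isMin isMin_bot
      | succ n ih =>
        intro x hx
        by_cases hm : IsMin x
        · exact ⟨1, WithBot.pred_coe_of_isMin hm⟩
        · obtain ⟨m, hm'⟩ := ih (Order.pred x) (by rwa [Function.iterate_succ_apply] at hx)
          refine ⟨m + 1, ?_⟩
          rw [Function.iterate_succ_apply, WithBot.pred_coe_of_not_isMin hm]
          exact hm'
    have key2 : ∀ (n : ℕ) (x y : T), Order.pred^[n] y = x →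
        ∃ m, Order.pred^[m] (y : WithBot T) = x := by
      intro n
      induction n with
      | zero => intro x y hy; exact ⟨0, congrArg WithBot.some hy⟩
      | succ n ih =>
        intro x y hy
        rw [Function.iterate_succ_apply] at hy
        by_cases hm : IsMin y
        · rw [Order.pred_eq_iff_isMin.2 hm] at hy
          exact ih x y hy
        · obtain ⟨m, hm'⟩ := ih x _ hy
          refine ⟨m + 1, ?_⟩
          rw [Function.iterate_succ_apply, WithBot.pred_coe_of_not_isMin hm]
          exact hm'
    induction b with
    | bot => exact ⟨0, (le_bot_iff.1 h).symm⟩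
    | coe y =>
      induction a with
      | bot =>
        obtain ⟨n, hn⟩ := (bot_le (a := y)).exists_pred_iterate
        exact key n y hn
      | coe x =>
        obtain ⟨n, hn⟩ := (WithBot.coe_le_coe.1 h).exists_pred_iterate
        exact key2 n x y hn

open scoped Classical in
/-- The rooted tree obtained from `T` by adding a new root above the root of `T`, so that the old
root becomes the only child of the new one. -/
noncomputable def addRoot (T : RootedTree) : RootedTree where
  α := WithBot T

/-- The rooted tree obtained from `T` by adding a chain of `k` vertices above the root. -/
noncomputable def addChain (T : RootedTree) : ℕ → RootedTree
  | 0 => T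
  | k + 1 => addRoot (addChain T k)

/-- A vertex of `T`, as a vertex of `T.addChain k`. -/
def toAddChain (T : RootedTree) : (k : ℕ) → T → T.addChain k
  | 0, v => v
  | k + 1, v => (WithBot.some (toAddChain T k v) : WithBot (T.addChain k))

/-- The tree `G(T; n)`, for `n ≥ |V(T)|`: a chain of `n - |V(T)|` vertices is added above the root
of `T`. -/
noncomputable abbrev extend (T : RootedTree) (n : ℕ) : RootedTree :=
  T.addChain (n - Nat.card T)

/-- The vertices of `G(T; n)` that come from a given set of vertices of `T`. -/
def inExtend (T : RootedTree) (n : ℕ) (N : Set T) : Set (T.extend n) :=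
  T.toAddChain (n - Nat.card T) '' N

/-- `Des(w) = {v | w(v) > w(p(v))}` for a labeling `w` of the vertices by `Fin n`, the labels being
`0, …, n - 1` instead of `1, …, n`. The root is never a descent because `Order.pred ⊥ = ⊥`. -/
def descents {S : RootedTree} {n : ℕ} (w : S ≃ Fin n) : Set S :=
  {v | w (Order.pred v) < w v}

/-- `d(T; n)`, for `n ≥ |V(T)|`: the number of labelings of `G(T; n)` with descent set `D`. -/
noncomputable def descentCount (T : RootedTree) (D : Set T) (n : ℕ) : ℕ :=
  Nat.card {w : T.extend n ≃ Fin n // descents w = T.inExtend n D}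

/-- The forest obtained from `S` by deleting the edges between the vertices in `N` and their
parents. The edges of `S` are those of the Hasse diagram of the ancestor order. Its connected
components are the pieces `T₀, T₁, …`; if `N` contains the root of `S`, this has no effect. -/
def cut (S : RootedTree) (N : Set S) : SimpleGraph S :=
  (SimpleGraph.hasse S).deleteEdges ((fun v => s(v, Order.pred v)) '' N)

/-- The hook length of a vertex `v` of the piece `C`, calculated within `C`: the number of vertices
of `C` that are descendants of `v`, including `v` itself. -/
noncomputable def hookLength {S : RootedTree} {N : Set S} (C : (S.cut N).ConnectedComponent)
    (v : S) : ℕ :=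
  {u : S | u ∈ C.supp ∧ v ≤ u}.ncard

/-- The product, over the pieces `C` obtained by cutting `S` at `N`, of `1 / ∏ h_v`, where `v` runs
through the vertices of `C` and `h_v` is calculated within `C`. (All trees in use are finite.) -/
noncomputable def hookProduct (S : RootedTree) (N : Set S) : ℚ :=
  ∏ᶠ C : (S.cut N).ConnectedComponent, 1 / ∏ᶠ v ∈ C.supp, (hookLength C v : ℚ)

end RootedTree

/-!
Write `S = G(T; n)`. For a set `N` of vertices, the labelings `w` with `Des(w) ⊆ N` are those that
decrease along every edge of `S` not cut at `N`, hence the antitone bijections onto `Fin n` for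
the order `u ≤ v in S, and u, v lie in the same piece` (`cutOrder`,
`antitone_cutOrder_iff_descents_subset`). This order is a forest, and its up-sets `{u | v ≤ u}` are
those whose sizes are the hook lengths within the pieces.

The hook length formula for forests (`card_antitone_equiv_fin`) therefore counts these labelings as
`n!` times `hookProduct`. It is proved by induction on `n`: the largest label sits on a minimal
element `r`; deleting `r` changes no other hook length, so the induction hypothesis contributes
`(n - 1)! · h_r / ∏ h_v`, and `∑ h_r = n` because every vertex lies above exactly one minimal
element.

Finally, inclusion-exclusion over `N ⊆ D` (`sum_powerset_neg_one_pow_sub_card_mul_ite_subset`)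
passes from `Des(w) ⊆ N` to `Des(w) = D`.
-/

/-! ### The hook length formula for forests -/

section Forest

variable {α : Type*}

/-- Antitone labelings with the largest label on the minimal element `r` are the antitone labelings
of the complement of `r`. -/
lemma card_antitone_equiv_fin_apply_eq_last [PartialOrder α] {n : ℕ} {r : α} (hr : IsMin r) :
    Nat.card {w : α ≃ Fin (n + 1) // Antitone w ∧ w r = Fin.last n} =
      Nat.card {w : {x // x ≠ r} ≃ Fin n // Antitone w} := by
  classical
  let F (e : {x // x ≠ r} ≃ Fin n) : α ≃ Fin (n + 1) :=
    (Equiv.optionSubtypeNe r).symm.trans (e.optionCongr.trans finSuccEquivLast.symm)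
  have F_self (e) : F e r = Fin.last n := by simp [F]
  have F_ne (e) (x : α) (hx : x ≠ r) : F e x = (e ⟨x, hx⟩).castSucc := by simp [F, hx]
  have F_anti (e : {x // x ≠ r} ≃ Fin n) : Antitone e ↔ Antitone (F e) := by
    constructor
    · intro h x y hxy
      by_cases hx : x = r
      · subst hx
        rw [F_self]
        exact Fin.le_last _
      · have hy : y ≠ r := fun hy => hx (hr.eq_of_le (hy ▸ hxy))
        rw [F_ne e x hx, F_ne e y hy, Fin.castSucc_le_castSucc_iff]
        exact h hxy
    · intro h x y hxy
      have := h (show (x : α) ≤ y from hxy)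
      rwa [F_ne e x x.2, F_ne e y y.2, Fin.castSucc_le_castSucc_iff] at this
  refine (Nat.card_congr (Equiv.ofBijective
    (fun e => ⟨F e.1, (F_anti e.1).1 e.2, F_self e.1⟩) ⟨?_, ?_⟩)).symm
  · intro e e' h
    ext x
    have := DFunLike.congr_fun (Subtype.ext_iff.1 h) (x : α)
    simp only [F_ne _ _ x.2] at this
    simpa using congrArg Fin.val this
  · rintro ⟨w, hw, hwr⟩
    let e : {x // x ≠ r} ≃ Fin n :=
      (w.subtypeEquiv (q := (· ≠ Fin.last n)) fun x => by
        rw [← hwr, w.injective.ne_iff]).trans (finSuccAboveEquiv (Fin.last n)).symm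
    have he : F e = w := by
      ext1 x
      by_cases hx : x = r
      · rw [hx, F_self, hwr]
      · rw [F_ne e x hx]
        have := (finSuccAboveEquiv (Fin.last n)).apply_symm_apply
          ⟨w x, fun h => hx (w.injective (h.trans hwr.symm))⟩
        exact (Fin.succAbove_last_apply _).symm.trans (Subtype.ext_iff.1 this)
    exact ⟨⟨e, (F_anti e).2 (he ▸ hw)⟩, Subtype.ext he⟩

/-- In a finite forest every element lies above exactly one minimal element. -/
lemma sum_ncard_Ici_isMin [PartialOrder α] [Fintype α] [DecidablePred (IsMin : α → Prop)]
    (hf : ∀ a b c : α, a ≤ c → b ≤ c → a ≤ b ∨ b ≤ a) :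
    ∑ r : α with IsMin r, (Set.Ici r).ncard = Fintype.card α := by
  classical
  have (r : α) : (Set.Ici r).ncard = ∑ v : α, if r ≤ v then 1 else 0 := by
    rw [Set.ncard_eq_toFinset_card', Finset.sum_boole, Nat.cast_id]
    congr 1
    ext
    simp
  simp_rw [this]
  rw [Finset.sum_comm, ← Finset.card_univ, Finset.card_eq_sum_ones]
  refine Finset.sum_congr rfl fun v _ => ?_
  obtain ⟨m, hmv, hm⟩ := (Set.toFinite (Set.univ : Set α)).exists_le_minimal (Set.mem_univ v)
  have hm' : IsMin m := fun b hb => hm.2 (Set.mem_univ b) hb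
  rw [Finset.sum_boole, Nat.cast_id, Finset.card_eq_one]
  refine ⟨m, Finset.ext fun r => ?_⟩
  simp only [Finset.mem_filter, Finset.mem_univ, true_and, Finset.mem_singleton]
  constructor
  · rintro ⟨hr, hrv⟩
    rcases hf r m v hrv hmv with h | h
    · exact hm'.eq_of_le h
    · exact (hr.eq_of_le h).symm
  · rintro rfl
    exact ⟨hm', hmv⟩

/-- The hook length formula for a finite forest, whose roots are its minimal elements. -/
theorem card_antitone_equiv_fin (n : ℕ) [PartialOrder α] [Fintype α] (hn : Fintype.card α = n)
    (hf : ∀ a b c : α, a ≤ c → b ≤ c → a ≤ b ∨ b ≤ a) :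
    (Nat.card {w : α ≃ Fin n // Antitone w} : ℚ) =
      n.factorial / ∏ v : α, ((Set.Ici v).ncard : ℚ) := by
  classical
  induction n generalizing α with
  | zero =>
    have := Fintype.card_eq_zero_iff.1 hn
    have : Unique {w : α ≃ Fin 0 // Antitone w} :=
      { default := ⟨Equiv.equivOfIsEmpty _ _, fun a => isEmptyElim a⟩
        uniq := fun w => Subtype.ext (Equiv.ext fun a => isEmptyElim a) }
    simp
  | succ n ih =>
    have hpos (v : α) : ((Set.Ici v).ncard : ℚ) ≠ 0 := by
      have : 0 < (Set.Ici v).ncard := (Set.ncard_pos (Set.toFinite _)).2 ⟨v, le_rfl⟩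
      exact_mod_cast this.ne'
    -- Split according to the vertex that carries the largest label.
    have hsplit : Nat.card {w : α ≃ Fin (n + 1) // Antitone w} =
        ∑ r : α, Nat.card {w : α ≃ Fin (n + 1) // Antitone w ∧ w r = Fin.last n} := by
      rw [← Nat.card_sigma]
      refine Nat.card_congr
        { toFun := fun w => ⟨w.1.symm (Fin.last n), w.1, w.2, by simp⟩
          invFun := fun w => ⟨w.2.1, w.2.2.1⟩
          left_inv := fun w => rfl
          right_inv := ?_ }
      rintro ⟨r, w, hw, hr⟩
      obtain rfl : r = w.symm (Fin.last n) := by rw [← hr, w.symm_apply_apply]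
      rfl
    have hnotmin (r : α) (hr : ¬ IsMin r) :
        Nat.card {w : α ≃ Fin (n + 1) // Antitone w ∧ w r = Fin.last n} = 0 := by
      refine Nat.card_eq_zero.2 (Or.inl ⟨fun ⟨w, hw, hwr⟩ => ?_⟩)
      obtain ⟨s, hs⟩ := not_isMin_iff.1 hr
      have := hw hs.le
      rw [hwr, Fin.last_le_iff, ← hwr] at this
      exact hs.ne (w.injective this)
    have hmin (r : α) (hr : IsMin r) :
        (Nat.card {w : α ≃ Fin (n + 1) // Antitone w ∧ w r = Fin.last n} : ℚ) =
          n.factorial / (∏ v : α, ((Set.Ici v).ncard : ℚ)) * (Set.Ici r).ncard := by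
      rw [card_antitone_equiv_fin_apply_eq_last hr,
        ih (α := {x // x ≠ r}) (by simp [Fintype.card_subtype_compl, hn]) (fun a b c => hf a b c)]
      have hIci (v : {x // x ≠ r}) : (Set.Ici v).ncard = (Set.Ici (v : α)).ncard := by
        rw [← Set.ncard_image_of_injective _ Subtype.val_injective]
        congr 1
        ext x
        simp only [Set.mem_image, Set.mem_Ici]
        constructor
        · rintro ⟨y, hy, rfl⟩
          exact hy
        · intro hx
          exact ⟨⟨x, fun h => v.2 (hr.eq_of_le (h ▸ hx))⟩, hx, rfl⟩
      simp_rw [hIci]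
      rw [Fintype.prod_eq_mul_prod_subtype_ne _ r]
      have h1 := hpos r
      have h2 : ∏ v : {x // x ≠ r}, ((Set.Ici (v : α)).ncard : ℚ) ≠ 0 :=
        Finset.prod_ne_zero_iff.2 fun v _ => hpos v
      field_simp
    rw [hsplit, ← Finset.sum_filter_add_sum_filter_not _ (fun r : α => IsMin r),
      Finset.sum_eq_zero (s := Finset.univ.filter fun r : α => ¬ IsMin r)
        (fun r hr => hnotmin r (Finset.mem_filter.1 hr).2), add_zero, Nat.cast_sum,
      Finset.sum_congr rfl fun r hr => hmin r (Finset.mem_filter.1 hr).2, ← Finset.mul_sum,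
      ← Nat.cast_sum, sum_ncard_Ici_isMin hf, hn, Nat.factorial_succ]
    push_cast
    ring

end Forest

/-! ### Inclusion-exclusion -/

/-- Möbius inversion on the Boolean lattice, for the indicator of a single set `E`. -/
lemma sum_powerset_neg_one_pow_sub_card_mul_ite_subset {α : Type*} [DecidableEq α]
    (D E : Finset α) :
    ∑ N ∈ D.powerset, (-1 : ℚ) ^ (D.card - N.card) * (if E ⊆ N then 1 else 0) =
      if E = D then 1 else 0 := by
  by_cases hED : E ⊆ D
  · -- Expand the product of `1 - [i ∉ E]` over `i ∈ D`.
    have h := Finset.prod_add (fun _ => (1 : ℚ)) (fun i => if i ∈ E then 0 else -1) D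
    have hL : ∏ i ∈ D, ((1 : ℚ) + if i ∈ E then 0 else -1) = if E = D then 1 else 0 := by
      split_ifs with hE
      · subst hE
        exact Finset.prod_eq_one fun i hi => by simp [hi]
      · obtain ⟨i, hi, hiE⟩ := Finset.not_subset.1 fun h => hE (hED.antisymm h)
        exact Finset.prod_eq_zero hi (by simp [hiE])
    rw [← hL, h]
    refine Finset.sum_congr rfl fun N hN => ?_
    rw [Finset.prod_const_one, one_mul, ← Finset.card_sdiff_of_subset (Finset.mem_powerset.1 hN)]
    split_ifs with hEN
    · rw [mul_one, Finset.prod_congr rfl fun i hi =>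
        if_neg fun hiE => (Finset.mem_sdiff.1 hi).2 (hEN hiE), Finset.prod_const]
    · obtain ⟨i, hiE, hiN⟩ := Finset.not_subset.1 hEN
      rw [mul_zero]
      exact (Finset.prod_eq_zero (i := i) (Finset.mem_sdiff.2 ⟨hED hiE, hiN⟩)
        (by simp [hiE])).symm
  · rw [if_neg fun h => hED h.subset]
    refine Finset.sum_eq_zero fun N hN => ?_
    rw [if_neg fun h => hED (h.trans (Finset.mem_powerset.1 hN)), mul_zero]

/-- Inclusion-exclusion: the objects `w` whose set `f w` equals `D`, in terms of those whose set is
contained in `N`, for `N ⊆ D`. -/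
lemma card_eq_sum_powerset_card_subset {α ι : Type*} [Finite α] [Finite ι] (f : ι → Set α)
    (D : Finset α) :
    (Nat.card {w // f w = D} : ℚ) =
      ∑ N ∈ D.powerset, (-1 : ℚ) ^ (D.card - N.card) * Nat.card {w // f w ⊆ N} := by
  classical
  have := Fintype.ofFinite α
  have := Fintype.ofFinite ι
  have hcard (p : ι → Prop) : (Nat.card {w // p w} : ℚ) = ∑ w, if p w then 1 else 0 := by
    rw [Nat.card_eq_fintype_card, Fintype.card_subtype, Finset.sum_boole]
  simp_rw [hcard, Finset.mul_sum]
  rw [Finset.sum_comm]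
  refine Finset.sum_congr rfl fun w _ => ?_
  have h := sum_powerset_neg_one_pow_sub_card_mul_ite_subset D (f w).toFinset
  simp only [Set.toFinset_subset, ← Finset.coe_inj, Set.coe_toFinset] at h
  convert h.symm

namespace RootedTree

/-! ### The pieces as a forest order -/

section Cut

variable {S : RootedTree}

/-- The order on the vertices of `S` after cutting at `N`: `u` lies below `v` if `u ≤ v`
in `S` and both belong to the same piece. -/
@[reducible]
def cutOrder (S : RootedTree) (N : Set S) : PartialOrder S where
  le u v := u ≤ v ∧ (S.cut N).Reachable u v
  lt u v := (u ≤ v ∧ (S.cut N).Reachable u v) ∧ ¬(v ≤ u ∧ (S.cut N).Reachable v u)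
  le_refl u := ⟨le_rfl, .rfl⟩
  le_trans _ _ _ h h' := ⟨h.1.trans h'.1, h.2.trans h'.2⟩
  le_antisymm _ _ h h' := le_antisymm h.1 h'.1

lemma cut_adj_pred {N : Set S} {v : S} (hv : v ∉ N) (hv' : v ≠ ⊥) :
    (S.cut N).Adj (Order.pred v) v := by
  have hcov : Order.pred v ⋖ v := Order.pred_covBy_of_not_isMin (by rwa [isMin_iff_eq_bot])
  rw [cut, SimpleGraph.deleteEdges_adj, SimpleGraph.hasse_adj]
  refine ⟨Or.inl hcov, ?_⟩
  rintro ⟨x, hx, hxv⟩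
  rcases Sym2.eq_iff.1 hxv with ⟨h1, h2⟩ | ⟨h1, -⟩
  · -- The edge would be `{pred v, pred (pred v)}` with `pred (pred v) = v`.
    have := Order.pred_le (Order.pred v)
    rw [← h1, h2] at this
    exact hcov.lt.not_ge (h1 ▸ this)
  · exact hv (h1 ▸ hx)

/-- Cutting the edge above `v` separates the subtree at `v` from the other vertices. -/
lemma le_of_cut_reachable {N : Set S} {v u : S} (hv : v ∈ N) (h : (S.cut N).Reachable v u) :
    v ≤ u := by
  have step (x y : S) (hxy : (S.cut N).Adj x y) (hx : v ≤ x) : v ≤ y := by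
    rw [cut, SimpleGraph.deleteEdges_adj, SimpleGraph.hasse_adj] at hxy
    obtain ⟨h | h, hN⟩ := hxy
    · exact hx.trans h.le
    · have hy : y = Order.pred x :=
        (h.eq_or_eq (Order.le_pred_of_lt h.lt) (Order.pred_le x)).elim Eq.symm fun hp =>
          absurd (Order.le_pred_iff_isMin.1 hp.ge) (not_isMin_of_lt h.lt)
      rcases hx.eq_or_lt with rfl | hlt
      · exact absurd ⟨v, hv, by rw [hy]⟩ hN
      · exact hy ▸ Order.le_pred_of_lt hlt
  rw [SimpleGraph.reachable_iff_reflTransGen] at h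
  induction h with
  | refl => exact le_rfl
  | tail _ hadj ih => exact step _ _ hadj ih

/-- A labeling decreases along every uncut edge exactly when it is antitone for the order of the
pieces: if `u < v` lie in the same piece, then so does the parent of `v`, and `v ∉ N`. -/
lemma antitone_cutOrder_iff_descents_subset {n : ℕ} (N : Set S) (w : S ≃ Fin n) :
    (∀ u v : S, u ≤ v ∧ (S.cut N).Reachable u v → w v ≤ w u) ↔ descents w ⊆ N := by
  constructor
  · intro h v hv
    by_contra hvN
    have hlt : w (Order.pred v) < w v := hv
    have hbot : v ≠ ⊥ := by
      rintro rfl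
      simp at hlt
    exact hlt.not_ge (h _ _ ⟨Order.pred_le v, (cut_adj_pred hvN hbot).reachable⟩)
  · rintro h u v ⟨huv, hr⟩
    obtain ⟨k, hk⟩ := huv.exists_pred_iterate
    induction k generalizing v with
    | zero => exact (congrArg w hk).le
    | succ k ih =>
      rcases huv.eq_or_lt with rfl | hlt
      · exact le_rfl
      · have hvN : v ∉ N := fun hvN => hlt.not_ge (le_of_cut_reachable hvN hr.symm)
        have hadj := cut_adj_pred hvN (bot_le.trans_lt hlt).ne'
        have hle : w v ≤ w (Order.pred v) := not_lt.1 fun hd => hvN (h hd)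
        exact hle.trans (ih _ (Order.le_pred_of_lt hlt) (hr.trans hadj.symm.reachable) hk)

lemma hookProduct_eq_one_div_prod [Fintype S] (N : Set S) :
    S.hookProduct N = 1 / ∏ v : S, ((@Set.Ici S (cutOrder S N).toPreorder v).ncard : ℚ) := by
  classical
  have := Fintype.ofFinite (S.cut N).ConnectedComponent
  rw [hookProduct, finprod_eq_prod_of_fintype, Finset.prod_div_distrib, Finset.prod_const_one,
    ← Finset.prod_fiberwise Finset.univ (S.cut N).connectedComponentMk]
  congr 1
  refine Finset.prod_congr rfl fun C _ => ?_
  rw [finprod_mem_eq_prod_of_subset (t := Finset.univ.filter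
    ((S.cut N).connectedComponentMk · = C))]
  · refine Finset.prod_congr rfl fun v hv => ?_
    have hv := (Finset.mem_filter.1 hv).2
    rw [hookLength]
    congr 2
    ext u
    change u ∈ C.supp ∧ v ≤ u ↔ v ≤ u ∧ (S.cut N).Reachable v u
    rw [SimpleGraph.ConnectedComponent.mem_supp_iff, ← hv, SimpleGraph.ConnectedComponent.eq,
      and_comm, SimpleGraph.reachable_comm]
  · intro v hv
    simpa using hv.1
  · intro v hv
    simpa using hv

/-- The labelings whose descents lie in `N` are counted by the hook length formula of the forest
obtained by cutting at `N`. -/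
lemma card_descents_subset [Finite S] {n : ℕ} (hn : Nat.card S = n) (N : Set S) :
    (Nat.card {w : S ≃ Fin n // descents w ⊆ N} : ℚ) = n.factorial * S.hookProduct N := by
  have := Fintype.ofFinite S
  have h := @card_antitone_equiv_fin S n (cutOrder S N) _ (by rw [← hn, Nat.card_eq_fintype_card])
    fun a b c hac hbc => (le_total_of_directed hbc.1 hac.1).imp
      (fun hab => ⟨hab, hac.2.trans hbc.2.symm⟩) (fun hba => ⟨hba, hbc.2.trans hac.2.symm⟩)
  rw [hookProduct_eq_one_div_prod, mul_one_div, ← h]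
  congr 1
  exact Nat.card_congr (Equiv.subtypeEquivRight fun w =>
    (antitone_cutOrder_iff_descents_subset N w).symm.trans
      ⟨fun h u v huv => h u v huv, fun h u v huv => h huv⟩)

lemma card_descents_eq [Finite S] {n : ℕ} (hn : Nat.card S = n) (D : Finset S) :
    (Nat.card {w : S ≃ Fin n // descents w = D} : ℚ) =
      n.factorial * ∑ N ∈ D.powerset, (-1 : ℚ) ^ (D.card - N.card) * S.hookProduct N := by
  rw [card_eq_sum_powerset_card_subset, Finset.mul_sum]
  refine Finset.sum_congr rfl fun N _ => ?_
  rw [card_descents_subset hn]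
  ring

end Cut

/-! ### Adding a chain above the root -/

section Chain

variable (T : RootedTree)

lemma toAddChain_injective (k : ℕ) : Function.Injective (T.toAddChain k) := by
  induction k with
  | zero => exact Function.injective_id
  | succ k ih => exact (WithBot.coe_injective (α := T.addChain k)).comp ih

variable [Finite T]

instance finite_addChain (k : ℕ) : Finite (T.addChain k) := by
  induction k with
  | zero => assumption
  | succ k ih => exact inferInstanceAs (Finite (Option (T.addChain k)))

lemma card_addChain (k : ℕ) : Nat.card (T.addChain k) = Nat.card T + k := by
  induction k with
  | zero => rfl
  | succ k ih =>
    have : Nat.card (T.addChain (k + 1)) = Nat.card (T.addChain k) + 1 :=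
      Finite.card_option (α := T.addChain k)
    rw [this, ih, add_assoc]

end Chain

end RootedTree

theorem mainTheorem2 (T : RootedTree) [Finite T] (D : Finset T) :
    (∀ n : ℕ, Nat.card T ≤ n →
      (T.descentCount (D : Set T) n : ℚ) =
        (Nat.factorial n : ℚ) * ∑ N ∈ D.powerset,
          (-1 : ℚ) ^ (D.card - N.card) * (T.extend n).hookProduct (T.inExtend n (N : Set T))) ∧
    (T.descentCount (D : Set T) (Nat.card T) : ℚ) =
      (Nat.factorial (Nat.card T) : ℚ) * ∑ N ∈ D.powerset,
        (-1 : ℚ) ^ (D.card - N.card) * T.hookProduct (N : Set T) := by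
  classical
  have main (n : ℕ) (hn : Nat.card T ≤ n) : (T.descentCount (D : Set T) n : ℚ) =
      (Nat.factorial n : ℚ) * ∑ N ∈ D.powerset,
        (-1 : ℚ) ^ (D.card - N.card) * (T.extend n).hookProduct (T.inExtend n (N : Set T)) := by
    have hinj := T.toAddChain_injective (n - Nat.card T)
    have hcard : Nat.card (T.extend n) = n := by
      rw [T.card_addChain, Nat.add_sub_cancel' hn]
    have h := RootedTree.card_descents_eq hcard (D.image (T.toAddChain (n - Nat.card T)))
    rw [Finset.powerset_image,
      Finset.sum_image fun _ _ _ _ h => Finset.image_injective hinj h] at h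
    simp only [Finset.card_image_of_injective _ hinj, Finset.coe_image] at h
    exact h
  refine ⟨main, ?_⟩
  -- `Nat.card T - Nat.card T` is not `0` by definition, so the chain length is generalized.
  have hT (k : ℕ) (hk : k = 0) (N : Set T) :
      (T.addChain k).hookProduct (T.toAddChain k '' N) = T.hookProduct N := by
    subst hk
    exact congrArg T.hookProduct (Set.image_id N)
  rw [main _ le_rfl]
  congr 1
  exact Finset.sum_congr rfl fun N _ =>
    congrArg _ (hT (Nat.card T - Nat.card T) (Nat.sub_self _) N)
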